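/- For an integer $m\times r$ matrix $M$, let $H\le\mathbb{Z}^m$ be the subgroup generated by the columns of $M$, let $e_1,\dots,e_m$ be the standard basis of $\mathbb{Z}^m$, and let $M^{\mathrm{SACG}}$ be the Cayley graph of $\mathbb{Z}^m/H$ with respect to $S=\{H\pm e_1,\dots,H\pm e_m\}$ (vertices $x,y$ are adjacent when $y-x\in S$). Let $y_{31},y_{32}$ be integers with $0<y_{31}\le y_{32}$, and let $$X=\begin{pmatrix}1&0\\0&1\\y_{31}&y_{32}\end{pmatrix}^{\mathrm{SACG}}.$$ Then $X$ has no loops, and its chromatic number is $$\chi(X)=\begin{cases}2&\text{if } y_{31}\text{ and }y_{32}\text{ are both odd},\\ 4&\text{if } y_{31}=2\text{ and }3\mid y_{32},\\ 4&\text{if } y_{31}\not\equiv1\pmod 3\text{ and }y_{32}=y_{31}+1,\\ 3&\text{otherwise.}\end{cases}$$ Moreover, $X$ is isomorphic to the integer distance graph $\mathrm{Cay}(\mathbb{Z},\{\pm1,\pm y_{31},\pm y_{32}\})$, so the same formula gives the chromatic number of that graph. -/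

import Mathlib

/-- The subgroup `H` of `ℤ^m` of all integer linear combinations of the columns of `M`. -/
def relationSubgroup {m r : ℕ} (M : Matrix (Fin m) (Fin r) ℤ) : AddSubgroup (Fin m → ℤ) :=
  AddSubgroup.closure (Set.range M.col)

/-- The generating set `S = {H ± e₁, …, H ± e_m}` of `ℤ^m / H`. -/
def sacgGenerators {m r : ℕ} (M : Matrix (Fin m) (Fin r) ℤ) :
    Set ((Fin m → ℤ) ⧸ relationSubgroup M) :=
  {s | ∃ j : Fin m,
    s = ((Pi.single j 1 : Fin m → ℤ) : (Fin m → ℤ) ⧸ relationSubgroup M) ∨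
    s = ((-Pi.single j 1 : Fin m → ℤ) : (Fin m → ℤ) ⧸ relationSubgroup M)}

/-- In the Cayley graph of `ℤ^m / H` with respect to `S`, where `x` and `y` are joined when
`y - x ∈ S`, some vertex is joined to itself. -/
def SacgHasLoops {m r : ℕ} (M : Matrix (Fin m) (Fin r) ℤ) : Prop :=
  ∃ x : (Fin m → ℤ) ⧸ relationSubgroup M, x - x ∈ sacgGenerators M

/-- The standardized abelian Cayley graph with Heuberger matrix `M`: the Cayley graph of
`ℤ^m / H` with respect to `S`. As a `SimpleGraph` it does not record loops; these are recorded by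
`SacgHasLoops`. -/
def sacg {m r : ℕ} (M : Matrix (Fin m) (Fin r) ℤ) :
    SimpleGraph ((Fin m → ℤ) ⧸ relationSubgroup M) :=
  SimpleGraph.addCayley (sacgGenerators M)

/-- The integer distance graph `Cay(ℤ, {±a, ±b, ±c})`. -/
def distanceGraph (a b c : ℤ) : SimpleGraph ℤ :=
  SimpleGraph.addCayley {a, -a, b, -b, c, -c}

/-! ### Colourings of integer distance graphs by rotations -/

/-! The map `v ↦ v 2 - a * v 0 - b * v 1` identifies the quotient with `ℤ` and the generators with
`±1, ±a, ±b`, so everything reduces to the distance graph. For upper bounds, cut the circle into `q`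
equal arcs and colour `x` by the arc containing `j * x / m`. This is proper once `1`, `a` and `b`
are each rotated to distance at least `1 / q` from `0`; each case is a choice of `j / m`, usually
near `1 / 2` when `q = 3`. For lower bounds, a 2-colouring has period 2, and in both exceptional
families a 3-colouring is forced to have period 3, which contradicts one of the distances. -/

/-- Modulo `1`, the multiple `j * d / m` is at distance at least `1 / q` from `0`. -/
def IsRotationSeparated (q m j d : ℤ) : Prop :=
  ∃ k : ℤ, (q * k + 1) * m ≤ q * j * d ∧ q * j * d ≤ (q * k + q - 1) * m

/-- The difference of the two floors lies strictly between `q * k` and `q * k + q`. -/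
theorem IsRotationSeparated.ediv_ne {q m j d : ℤ} (hm : 0 < m)
    (h : IsRotationSeparated q m j d) (x : ℤ) :
    ¬ q ∣ q * j * (x + d) / m - q * j * x / m := by
  obtain ⟨k, hk₁, hk₂⟩ := h
  have hlow : q * j * x / m + (q * k + 1) ≤ q * j * (x + d) / m := by
    rw [Int.le_ediv_iff_mul_le hm]
    have := Int.ediv_mul_le (q * j * x) hm.ne'
    linarith
  have hupp : q * j * (x + d) / m < q * j * x / m + (q * k + q) := by
    rw [Int.ediv_lt_iff_lt_mul hm]
    have := Int.lt_ediv_add_one_mul_self (q * j * x) hm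
    linarith
  rintro ⟨l, hl⟩
  have h₁ : 1 ≤ q * (l - k) := by linarith
  have h₂ : q * (l - k) < q := by linarith
  by_cases hq : 0 < q
  · have : 0 < l - k := by
      by_contra hneg
      nlinarith
    nlinarith
  · nlinarith

theorem distanceGraph_adj_iff {a b c x y : ℤ} (ha : 0 < a) (hb : 0 < b) (hc : 0 < c) :
    (distanceGraph a b c).Adj x y ↔
      ∃ d : ℤ, (d = a ∨ d = b ∨ d = c) ∧ (y = x + d ∨ x = y + d) := by
  simp only [distanceGraph, SimpleGraph.addCayley_adj', Set.mem_insert_iff, Set.mem_singleton_iff]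
  constructor
  · rintro ⟨-, g, hg, h⟩
    rcases hg with rfl | rfl | rfl | rfl | rfl | rfl
    · exact ⟨_, Or.inl rfl, by omega⟩
    · exact ⟨_, Or.inl rfl, by omega⟩
    · exact ⟨_, Or.inr (Or.inl rfl), by omega⟩
    · exact ⟨_, Or.inr (Or.inl rfl), by omega⟩
    · exact ⟨_, Or.inr (Or.inr rfl), by omega⟩
    · exact ⟨_, Or.inr (Or.inr rfl), by omega⟩
  · rintro ⟨d, hd, h⟩
    exact ⟨by omega, d, by tauto, by omega⟩

theorem distanceGraph_colorable_of_separated {a b c : ℤ} (ha : 0 < a) (hb : 0 < b) (hc : 0 < c)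
    (q : ℕ) [NeZero q] {m j : ℤ} (hm : 0 < m) (h₁ : IsRotationSeparated q m j a)
    (h₂ : IsRotationSeparated q m j b) (h₃ : IsRotationSeparated q m j c) :
    (distanceGraph a b c).Colorable q := by
  have hstep : ∀ d : ℤ, (d = a ∨ d = b ∨ d = c) → ∀ x : ℤ,
      (((q : ℤ) * j * (x + d) / m : ℤ) : ZMod q) ≠ (((q : ℤ) * j * x / m : ℤ) : ZMod q) := by
    intro d hd x heq
    have hsep : IsRotationSeparated q m j d := by
      rcases hd with rfl | rfl | rfl <;> assumption
    exact hsep.ediv_ne hm x ((ZMod.intCast_eq_intCast_iff_dvd_sub _ _ _).1 heq.symm)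
  have C : (distanceGraph a b c).Coloring (ZMod q) :=
    SimpleGraph.Coloring.mk (fun x => (((q : ℤ) * j * x / m : ℤ) : ZMod q)) (by
      intro x y hxy
      obtain ⟨d, hd, rfl | rfl⟩ := (distanceGraph_adj_iff ha hb hc).1 hxy
      · exact (hstep d hd x).symm
      · exact hstep d hd y)
  simpa [ZMod.card] using C.colorable

/-- A rotation by `j / (a + b)` moves `a` and `b` to opposite points of the circle, so that only
`1` and `a` have to be controlled. -/
theorem distanceGraph_colorable_three_of_add {a b : ℤ} (ha : 0 < a) (hb : 0 < b) (j k : ℤ)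
    (h₁ : a + b ≤ 3 * j) (h₂ : 3 * j ≤ 2 * (a + b)) (h₃ : (3 * k + 1) * (a + b) ≤ 3 * j * a)
    (h₄ : 3 * j * a ≤ (3 * k + 2) * (a + b)) : (distanceGraph 1 a b).Colorable 3 := by
  refine distanceGraph_colorable_of_separated one_pos ha hb 3 (m := a + b) (j := j) (by omega)
    ⟨0, ?_, ?_⟩ ⟨k, ?_, ?_⟩ ⟨j - k - 1, ?_, ?_⟩ <;> push_cast <;> linarith

theorem distanceGraph_colorable_three_of_not_dvd {a b : ℤ} (ha : 0 < a) (hb : 0 < b)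
    (ha' : ¬ 3 ∣ a) (hb' : ¬ 3 ∣ b) : (distanceGraph 1 a b).Colorable 3 := by
  refine distanceGraph_colorable_of_separated one_pos ha hb 3 (m := 3) (j := 1) (by omega)
    ⟨0, ?_, ?_⟩ ⟨a / 3, ?_, ?_⟩ ⟨b / 3, ?_, ?_⟩ <;> push_cast <;> omega

theorem distanceGraph_colorable_two {a b : ℤ} (ha : 0 < a) (hb : 0 < b)
    (ha' : Odd a) (hb' : Odd b) : (distanceGraph 1 a b).Colorable 2 := by
  obtain ⟨c, rfl⟩ := ha'
  obtain ⟨d, rfl⟩ := hb'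
  refine distanceGraph_colorable_of_separated one_pos ha hb 2 (m := 2) (j := 1) (by omega)
    ⟨0, ?_, ?_⟩ ⟨c, ?_, ?_⟩ ⟨d, ?_, ?_⟩ <;> push_cast <;> omega

/-! ### Three colours -/

/-- Supplies a rotation numerator with prescribed residue modulo `p`: consecutive candidates are `s
* p` apart. -/
theorem exists_mul_mem_Icc_modEq {s : ℤ} (hs : 0 < s) (p r lo hi : ℤ) (hp : 0 < p)
    (h : lo + s * p ≤ hi) : ∃ l : ℤ, lo ≤ s * (p * l + r) ∧ s * (p * l + r) ≤ hi := by
  have hsp : 0 < s * p := mul_pos hs hp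
  refine ⟨(lo - s * r) / (s * p) + 1, ?_, ?_⟩
  · have := Int.lt_ediv_add_one_mul_self (lo - s * r) hsp
    linarith
  · have := Int.ediv_mul_le (lo - s * r) hsp.ne'
    linarith

theorem distanceGraph_colorable_three_of_odd_even {a b : ℤ} (ha : 0 < a) (hab : 2 * a ≤ b)
    (ha' : Odd a) (hb' : Even b) : (distanceGraph 1 a b).Colorable 3 := by
  obtain ⟨c, rfl⟩ := ha'
  obtain ⟨d, rfl⟩ := hb'
  -- With `N = a + b`, this rotation is `1/2 - 1/(2N)`; it sends `a` to `1/2 - a/(2N)` modulo 1, and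
  -- `3 * a ≤ N`.
  refine distanceGraph_colorable_three_of_add ha (by omega) (c + d) c ?_ ?_ ?_ ?_ <;> nlinarith

theorem distanceGraph_colorable_three_of_even_of_two_mul_le {a b : ℤ} (ha : 4 ≤ a)
    (hab : 2 * a ≤ b) (ha' : Even a) : (distanceGraph 1 a b).Colorable 3 := by
  obtain ⟨c, rfl⟩ := ha'
  -- With `N = a + b` and `n = 2 * l + b ≡ N` modulo 2, the rotation `1/2 - n/(2N)` sends `a = 2 *
  -- c` to `-c * n / N` modulo 1.
  obtain ⟨l, hl₁, hl₂⟩ := exists_mul_mem_Icc_modEq (s := 3 * c) (by omega) 2 b (c + c + b)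
    (2 * (c + c + b)) two_pos (by omega)
  have hn : 0 < 2 * l + b := by
    by_contra hneg
    nlinarith
  have hn' : 3 * (2 * l + b) ≤ c + c + b := by
    by_contra hneg
    nlinarith
  refine distanceGraph_colorable_three_of_add (by omega) (by omega) (c - l) (c - 1) ?_ ?_ ?_ ?_ <;>
    nlinarith

theorem distanceGraph_colorable_three_of_even_even {a b : ℤ} (ha : 4 ≤ a) (hab : a ≤ b)
    (hab' : b ≤ 2 * a) (ha' : Even a) (hb' : Even b) : (distanceGraph 1 a b).Colorable 3 := by
  obtain ⟨c, rfl⟩ := ha'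
  obtain ⟨d, rfl⟩ := hb'
  -- The rotation `1/2 - 1/(a + b)` sends `a` to `-a/(a + b)` modulo 1.
  refine distanceGraph_colorable_three_of_add (by omega) (by omega) (c + d - 1) (c - 1)
    ?_ ?_ ?_ ?_ <;> nlinarith

/-- Rotation by `1 / 2 - n / (2 * (2 * a + d))`, where `n ≡ 3` or `n ≡ 1` modulo `4` according to
the parity of `a`. -/
theorem distanceGraph_colorable_three_of_add_odd {a d l r : ℤ} (ha : 0 < a) (hd : 0 < d)
    (hd' : Odd d) (hr : (Even a ∧ r = 3) ∨ (Odd a ∧ r = 1))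
    (h₁ : 2 * a + d ≤ 3 * d * (4 * l + r)) (h₂ : 3 * d * (4 * l + r) ≤ 5 * (2 * a + d))
    (h₃ : 3 * (4 * l + r) ≤ 2 * a + d) : (distanceGraph 1 a (a + d)).Colorable 3 := by
  obtain ⟨e, rfl⟩ := hd'
  have hn : 0 < 4 * l + r := by
    by_contra hneg
    nlinarith
  -- With `N = 2 * a + d` and `n = 4 * l + r`, `a` goes to `a/2 - n/4 + d * n / (4N)`; the choice of
  -- `r` makes `a/2 - n/4 ≡ 1/4` modulo 1.
  rcases hr with ⟨⟨c, rfl⟩, rfl⟩ | ⟨⟨c, rfl⟩, rfl⟩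
  · refine distanceGraph_colorable_three_of_add ha (by omega) (2 * c + e - 2 * l - 1) (c - l - 1)
      ?_ ?_ ?_ ?_ <;> nlinarith
  · refine distanceGraph_colorable_three_of_add ha (by omega) (2 * c + 1 + e - 2 * l) (c - l)
      ?_ ?_ ?_ ?_ <;> nlinarith

theorem distanceGraph_colorable_three_of_odd_sub {a d : ℤ} (ha : 0 < a) (hd : 3 ≤ d)
    (hda : d < a) (hd' : Odd d) : (distanceGraph 1 a (a + d)).Colorable 3 := by
  obtain ⟨r, hr⟩ : ∃ r : ℤ, (Even a ∧ r = 3) ∨ (Odd a ∧ r = 1) := by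
    rcases Int.even_or_odd a with h | h
    · exact ⟨3, Or.inl ⟨h, rfl⟩⟩
    · exact ⟨1, Or.inr ⟨h, rfl⟩⟩
  by_cases h5 : 5 ≤ d
  · obtain ⟨l, hl₁, hl₂⟩ := exists_mul_mem_Icc_modEq (s := 3 * d) (by omega) 4 r (2 * a + d)
      (5 * (2 * a + d)) four_pos (by omega)
    refine distanceGraph_colorable_three_of_add_odd ha (by omega) hd' hr hl₁ hl₂ ?_
    by_contra hneg
    nlinarith
  · obtain rfl : d = 3 := by
      obtain ⟨e, rfl⟩ := hd'
      omega
    -- For `d = 3` the bound `3 * n ≤ N` shortens the window to `[N, 3N]`, long enough once `8 ≤ a`;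
    -- only `a = 6` is left over.
    by_cases h3 : 3 ∣ a
    · by_cases h8 : 8 ≤ a
      · obtain ⟨l, hl₁, hl₂⟩ := exists_mul_mem_Icc_modEq (s := 9) (by omega) 4 r (2 * a + 3)
          (3 * (2 * a + 3)) four_pos (by omega)
        exact distanceGraph_colorable_three_of_add_odd (l := l) ha (by omega) hd' hr (by omega) (by omega)
          (by omega)
      · obtain rfl : a = 6 := by omega
        exact distanceGraph_colorable_three_of_add_odd (l := 0) (r := 3) ha (by omega) hd'
          (Or.inl ⟨⟨3, rfl⟩, rfl⟩) (by omega) (by omega) (by omega)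
    · exact distanceGraph_colorable_three_of_not_dvd ha (by omega) h3 (by omega)

theorem distanceGraph_colorable_three {a b : ℤ} (ha : 0 < a) (hab : a ≤ b)
    (hodd : ¬ (Odd a ∧ Odd b)) (h₁ : ¬ (a = 2 ∧ 3 ∣ b))
    (h₂ : ¬ (¬ a ≡ 1 [ZMOD 3] ∧ b = 1 + a)) : (distanceGraph 1 a b).Colorable 3 := by
  by_cases ha2 : a = 2
  · exact distanceGraph_colorable_three_of_not_dvd ha (by omega) (by omega) (by tauto)
  rcases Int.even_or_odd a with hae | hao
  · have ha4 : 4 ≤ a := by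
      obtain ⟨c, rfl⟩ := hae
      omega
    rcases le_or_gt (2 * a) b with h | h
    · exact distanceGraph_colorable_three_of_even_of_two_mul_le ha4 h hae
    rcases Int.even_or_odd b with hbe | hbo
    · exact distanceGraph_colorable_three_of_even_even ha4 hab h.le hae hbe
    by_cases hb1 : b = 1 + a
    · have : a % 3 = 1 := by
        by_contra hne
        exact h₂ ⟨hne, hb1⟩
      exact distanceGraph_colorable_three_of_not_dvd ha (by omega) (by omega) (by omega)
    · obtain ⟨d, rfl⟩ : ∃ d, b = a + d := ⟨b - a, by ring⟩
      have hd : Odd d := by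
        rw [Int.odd_add] at hbo
        by_contra hd
        exact (Int.not_odd_iff_even.2 hae) (hbo.2 (Int.not_odd_iff_even.1 hd))
      have : d ≠ 0 := by
        rintro rfl
        simp at hd
      have : d ≠ 2 := by
        rintro rfl
        exact absurd hd (by decide)
      exact distanceGraph_colorable_three_of_odd_sub ha (by omega) (by omega) hd
  · have hbe : Even b := Int.not_odd_iff_even.1 fun hb => hodd ⟨hao, hb⟩
    rcases le_or_gt (2 * a) b with h | h
    · exact distanceGraph_colorable_three_of_odd_even ha h hao hbe
    by_cases hb1 : b = 1 + a
    · have : a % 3 = 1 := by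
        by_contra hne
        exact h₂ ⟨hne, hb1⟩
      exact distanceGraph_colorable_three_of_not_dvd ha (by omega) (by omega) (by omega)
    · obtain ⟨d, rfl⟩ : ∃ d, b = a + d := ⟨b - a, by ring⟩
      have hd : Odd d := by
        obtain ⟨c, rfl⟩ := hao
        obtain ⟨e, he⟩ := hbe
        exact ⟨e - c - 1, by omega⟩
      have : d ≠ 0 := by
        rintro rfl
        simp at hd
      have : d ≠ 2 := by
        rintro rfl
        exact absurd hd (by decide)
      exact distanceGraph_colorable_three_of_odd_sub ha (by omega) (by omega) hd

/-! ### Four colours -/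

theorem distanceGraph_colorable_four_of_not_dvd {a b : ℤ} (ha : 0 < a) (hb : 0 < b)
    (ha' : ¬ 4 ∣ a) (hb' : ¬ 4 ∣ b) : (distanceGraph 1 a b).Colorable 4 := by
  refine distanceGraph_colorable_of_separated one_pos ha hb 4 (m := 4) (j := 1) (by omega)
    ⟨0, ?_, ?_⟩ ⟨a / 4, ?_, ?_⟩ ⟨b / 4, ?_, ?_⟩ <;> push_cast <;> omega

theorem distanceGraph_one_two_colorable_four {b : ℤ} (hb : 0 < b) :
    (distanceGraph 1 2 b).Colorable 4 := by
  by_cases h : 4 ∣ b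
  · obtain ⟨c, rfl⟩ := h
    have hc : 1 ≤ c := by omega
    -- The rotation `1/4 + 1/(4b)` sends `b` to `1/4` modulo 1.
    refine distanceGraph_colorable_of_separated one_pos two_pos hb 4 (m := 4 * (4 * c))
      (j := 4 * c + 1) (by omega) ⟨0, ?_, ?_⟩ ⟨0, ?_, ?_⟩ ⟨c, ?_, ?_⟩ <;> push_cast <;> nlinarith
  · exact distanceGraph_colorable_four_of_not_dvd two_pos hb (by omega) h

theorem distanceGraph_one_add_colorable_four {a : ℤ} (ha : 2 ≤ a) :
    (distanceGraph 1 a (1 + a)).Colorable 4 := by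
  rcases Int.even_or_odd a with ⟨c, rfl⟩ | ⟨c, rfl⟩
  · by_cases hc : c = 1
    · subst hc
      exact distanceGraph_colorable_four_of_not_dvd (by omega) (by omega) (by omega) (by omega)
    have hc' : 2 ≤ c := by omega
    -- The rotation `1/2 + 3/(4a)` sends `a` to `3/4` modulo 1; for odd `a`, `1/2 + 1/(4a)` does the
    -- same.
    refine distanceGraph_colorable_of_separated one_pos (by omega) (by omega) 4
      (m := 4 * (c + c)) (j := 2 * (c + c) + 3) (by omega) ⟨0, ?_, ?_⟩ ⟨c, ?_, ?_⟩ ⟨c + 1, ?_, ?_⟩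
      <;> push_cast <;> nlinarith
  · refine distanceGraph_colorable_of_separated one_pos (by omega) (by omega) 4
      (m := 4 * (2 * c + 1)) (j := 2 * (2 * c + 1) + 1) (by omega)
      ⟨0, ?_, ?_⟩ ⟨c, ?_, ?_⟩ ⟨c + 1, ?_, ?_⟩ <;> push_cast <;> nlinarith

/-! ### Lower bounds -/

theorem SimpleGraph.Coloring.ne_add_of_distanceGraph {α : Type*} {a b c : ℤ}
    (ha : 0 < a) (hb : 0 < b) (hc : 0 < c) (f : (distanceGraph a b c).Coloring α) (x : ℤ) :
    f x ≠ f (x + a) ∧ f x ≠ f (x + b) ∧ f x ≠ f (x + c) :=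
  ⟨f.valid ((distanceGraph_adj_iff ha hb hc).2 ⟨a, by simp⟩),
    f.valid ((distanceGraph_adj_iff ha hb hc).2 ⟨b, by simp⟩),
    f.valid ((distanceGraph_adj_iff ha hb hc).2 ⟨c, by simp⟩)⟩

theorem distanceGraph_not_colorable_one {a b : ℤ} (ha : 0 < a) (hb : 0 < b) :
    ¬ (distanceGraph 1 a b).Colorable 1 := by
  rintro ⟨f⟩
  exact (f.ne_add_of_distanceGraph one_pos ha hb 0).1 (Subsingleton.elim _ _)

theorem distanceGraph_not_colorable_two {a b : ℤ} (ha : 0 < a) (hb : 0 < b)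
    (h : ¬ (Odd a ∧ Odd b)) : ¬ (distanceGraph 1 a b).Colorable 2 := by
  rintro ⟨f⟩
  have hne := f.ne_add_of_distanceGraph one_pos ha hb
  have key : ∀ p q r : Fin 2, p ≠ q → q ≠ r → r = p := by decide
  have hper : Function.Periodic f 2 := fun x => by
    have := (hne (x + 1)).1
    rw [add_assoc] at this
    exact key _ _ _ (hne x).1 this
  have hev : ∀ d : ℤ, Even d → f 0 = f (0 + d) := by
    rintro d ⟨c, rfl⟩
    have := (hper.int_mul c) 0
    rw [← this, Int.cast_id, mul_two]
  rcases not_and_or.1 h with h | h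
  · exact (hne 0).2.1 (hev a (Int.not_odd_iff_even.1 h))
  · exact (hne 0).2.2 (hev b (Int.not_odd_iff_even.1 h))

theorem periodic_three_of_ne {f : ℤ → Fin 3} (h₁ : ∀ x, f x ≠ f (x + 1))
    (h₂ : ∀ x, f x ≠ f (x + 2)) : Function.Periodic f 3 := fun x => by
  have key : ∀ p q r s : Fin 3, p ≠ q → p ≠ r → q ≠ r → q ≠ s → r ≠ s → s = p := by omega
  refine key (f x) (f (x + 1)) (f (x + 2)) (f (x + 3)) (h₁ x) (h₂ x) ?_ ?_ ?_
  · simpa [add_assoc] using h₁ (x + 1)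
  · simpa [add_assoc] using h₂ (x + 1)
  · simpa [add_assoc] using h₁ (x + 2)

theorem distanceGraph_one_two_not_colorable_three {b : ℤ} (hb : 0 < b) (h : 3 ∣ b) :
    ¬ (distanceGraph 1 2 b).Colorable 3 := by
  rintro ⟨f⟩
  have hne := f.ne_add_of_distanceGraph one_pos two_pos hb
  have hper := periodic_three_of_ne (fun x => (hne x).1) (fun x => (hne x).2.1)
  obtain ⟨c, rfl⟩ := h
  have := (hper.int_mul c) 0
  rw [Int.cast_id, mul_comm c 3] at this
  exact (hne 0).2.2 this.symm

theorem distanceGraph_one_add_not_colorable_three {a : ℤ} (ha : 0 < a) (h : ¬ a ≡ 1 [ZMOD 3]) :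
    ¬ (distanceGraph 1 a (1 + a)).Colorable 3 := by
  rintro ⟨f⟩
  have hne := f.ne_add_of_distanceGraph one_pos ha (by omega)
  have key : ∀ p q r s : Fin 3, p ≠ q → p ≠ r → p ≠ s → q ≠ s → r ≠ s → r = q := by omega
  -- Both `x + 1` and `x + a` are adjacent to the adjacent vertices `x` and `x + 1 + a`, so both get
  -- the third colour.
  have heq : ∀ x, f (x + a) = f (x + 1) := fun x => by
    refine key (f x) _ _ (f (x + (1 + a))) (hne x).1 (hne x).2.1 (hne x).2.2 ?_ ?_
    · simpa [add_assoc] using (hne (x + 1)).2.1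
    · simpa [add_assoc, add_comm, add_left_comm] using (hne (x + a)).1
  have h₂ : ∀ x, f x ≠ f (x + 2) := fun x => by
    have h₃ := (hne x).2.2
    have h₄ := heq (x + 1)
    rw [add_assoc, add_assoc] at h₄
    rwa [h₄] at h₃
  have hper := periodic_three_of_ne (fun x => (hne x).1) h₂
  have hmod : ∀ x, f (x + a) = f (x + a % 3) := fun x => by
    have := (hper.int_mul (a / 3)) (x + a % 3)
    rw [Int.cast_id, add_assoc, mul_comm, Int.emod_add_mul_ediv] at this
    exact this
  have h₅ := (hmod 0).symm.trans (heq 0)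
  have h₆ : a % 3 = 0 ∨ a % 3 = 2 := by
    have : a % 3 ≠ 1 := h
    omega
  rcases h₆ with h₆ | h₆ <;> rw [h₆] at h₅
  · exact (hne 0).1 (by simpa using h₅)
  · exact (hne (0 + 1)).1 h₅.symm

theorem distanceGraph_one_chromaticNumber {a b : ℤ} (ha : 0 < a) (hab : a ≤ b) :
    (distanceGraph 1 a b).chromaticNumber =
      (if Odd a ∧ Odd b then 2
       else if a = 2 ∧ 3 ∣ b then 4
       else if ¬ a ≡ 1 [ZMOD 3] ∧ b = 1 + a then 4
       else 3) := by
  have hb : 0 < b := by omega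
  split_ifs with h₁ h₂ h₃
  · exact SimpleGraph.chromaticNumber_eq_iff_colorable_not_colorable (n := 1).2
      ⟨distanceGraph_colorable_two ha hb h₁.1 h₁.2, distanceGraph_not_colorable_one ha hb⟩
  · obtain ⟨rfl, h⟩ := h₂
    exact SimpleGraph.chromaticNumber_eq_iff_colorable_not_colorable (n := 3).2
      ⟨distanceGraph_one_two_colorable_four hb, distanceGraph_one_two_not_colorable_three hb h⟩
  · obtain ⟨h, rfl⟩ := h₃
    have ha1 : a ≠ 1 := by
      rintro rfl
      exact h rfl
    exact SimpleGraph.chromaticNumber_eq_iff_colorable_not_colorable (n := 3).2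
      ⟨distanceGraph_one_add_colorable_four (by omega),
        distanceGraph_one_add_not_colorable_three ha h⟩
  · exact SimpleGraph.chromaticNumber_eq_iff_colorable_not_colorable (n := 2).2
      ⟨distanceGraph_colorable_three ha hab h₁ h₂ h₃, distanceGraph_not_colorable_two ha hb h₁⟩

/-! ### The standardized abelian Cayley graph as a distance graph -/

/-- The homomorphism `ℤ³ → ℤ` whose kernel is generated by `(1, 0, a)` and `(0, 1, b)`. -/
def heubergerHom (a b : ℤ) : (Fin 3 → ℤ) →+ ℤ where
  toFun v := v 2 - a * v 0 - b * v 1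
  map_zero' := by simp
  map_add' v w := by simp only [Pi.add_apply]; ring

theorem relationSubgroup_eq_ker (a b : ℤ) :
    relationSubgroup !![1, 0; 0, 1; a, b] = (heubergerHom a b).ker := by
  apply le_antisymm
  · rw [relationSubgroup, AddSubgroup.closure_le]
    rintro _ ⟨i, rfl⟩
    fin_cases i <;> simp [heubergerHom, AddMonoidHom.mem_ker]
  · intro v hv
    have hv' : v 2 - a * v 0 - b * v 1 = 0 := hv
    have hcol : v = v 0 • (!![1, 0; 0, 1; a, b] : Matrix (Fin 3) (Fin 2) ℤ).col 0 +
        v 1 • (!![1, 0; 0, 1; a, b] : Matrix (Fin 3) (Fin 2) ℤ).col 1 := by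
      funext i
      fin_cases i
      · simp
      · simp
      · simp
        linarith
    rw [hcol]
    exact add_mem (zsmul_mem (AddSubgroup.subset_closure (Set.mem_range_self 0)) _)
      (zsmul_mem (AddSubgroup.subset_closure (Set.mem_range_self 1)) _)

/-- The quotient of `ℤ³` by the relations `(1, 0, a)` and `(0, 1, b)` is infinite cyclic. -/
noncomputable def heubergerEquiv (a b : ℤ) :
    (Fin 3 → ℤ) ⧸ relationSubgroup !![1, 0; 0, 1; a, b] ≃+ ℤ :=
  (QuotientAddGroup.quotientAddEquivOfEq (relationSubgroup_eq_ker a b)).trans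
    (QuotientAddGroup.quotientKerEquivOfRightInverse (heubergerHom a b) (fun z => Pi.single 2 z)
      (fun z => by simp [heubergerHom]))

theorem heubergerEquiv_mk (a b : ℤ) (v : Fin 3 → ℤ) :
    heubergerEquiv a b (v : (Fin 3 → ℤ) ⧸ relationSubgroup !![1, 0; 0, 1; a, b]) =
      v 2 - a * v 0 - b * v 1 := rfl

theorem mem_sacgGenerators_iff (a b : ℤ)
    (s : (Fin 3 → ℤ) ⧸ relationSubgroup !![1, 0; 0, 1; a, b]) :
    s ∈ sacgGenerators !![1, 0; 0, 1; a, b] ↔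
      heubergerEquiv a b s ∈ ({1, -1, a, -a, b, -b} : Set ℤ) := by
  simp only [sacgGenerators, Set.mem_ofPred_eq, ← (heubergerEquiv a b).injective.eq_iff,
    heubergerEquiv_mk, Fin.exists_fin_succ, Set.mem_insert_iff, Set.mem_singleton_iff]
  simp
  tauto

/-- The Cayley graph with Heuberger matrix having columns `(1, 0, a)` and `(0, 1, b)` is the
distance graph of `1`, `a` and `b`. -/
noncomputable def sacgIsoDistanceGraph (a b : ℤ) :
    sacg !![1, 0; 0, 1; a, b] ≃g distanceGraph 1 a b where
  toEquiv := (heubergerEquiv a b).toEquiv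
  map_rel_iff' {x y} := by
    simp only [sacg, distanceGraph, SimpleGraph.addCayley_adj', mem_sacgGenerators_iff]
    refine and_congr (heubergerEquiv a b).injective.ne_iff ?_
    constructor
    · rintro ⟨g, hg, h⟩
      refine ⟨(heubergerEquiv a b).symm g, by simpa using hg, ?_⟩
      simpa [← (heubergerEquiv a b).injective.eq_iff] using h
    · rintro ⟨g, hg, h⟩
      refine ⟨heubergerEquiv a b g, hg, ?_⟩
      simpa [← (heubergerEquiv a b).injective.eq_iff] using h

theorem not_sacgHasLoops {a b : ℤ} (ha : 0 < a) (hb : 0 < b) :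
    ¬ SacgHasLoops !![1, 0; 0, 1; a, b] := by
  rintro ⟨x, hx⟩
  rw [sub_self, mem_sacgGenerators_iff, map_zero] at hx
  simp only [Set.mem_insert_iff, Set.mem_singleton_iff] at hx
  omega

theorem SimpleGraph.Iso.chromaticNumber_congr {V W : Type*} {G : SimpleGraph V}
    {H : SimpleGraph W} (e : G ≃g H) : G.chromaticNumber = H.chromaticNumber :=
  le_antisymm (chromaticNumber_mono_of_hom e.toHom) (chromaticNumber_mono_of_hom e.symm.toHom)

theorem mainTheorem8 (y₃₁ y₃₂ : ℤ) (h₁ : 0 < y₃₁) (h₂ : y₃₁ ≤ y₃₂) :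
    ¬ SacgHasLoops !![1, 0; 0, 1; y₃₁, y₃₂] ∧
    (sacg !![1, 0; 0, 1; y₃₁, y₃₂]).chromaticNumber =
      (if Odd y₃₁ ∧ Odd y₃₂ then 2
       else if y₃₁ = 2 ∧ 3 ∣ y₃₂ then 4
       else if ¬ y₃₁ ≡ 1 [ZMOD 3] ∧ y₃₂ = 1 + y₃₁ then 4
       else 3) ∧
    Nonempty (sacg !![1, 0; 0, 1; y₃₁, y₃₂] ≃g distanceGraph 1 y₃₁ y₃₂) := by
  refine ⟨not_sacgHasLoops h₁ (by omega), ?_, ⟨sacgIsoDistanceGraph y₃₁ y₃₂⟩⟩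
  rw [(sacgIsoDistanceGraph y₃₁ y₃₂).chromaticNumber_congr]
  exact distanceGraph_one_chromaticNumber h₁ h₂
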